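/- Let $d,s$ be positive integers, let $p$ be an odd prime and let $r\in\{1,-1\}$. Assume that $p^s+r\ge d\ge 3$, $\gcd(p,d)=1$ and $p^s\equiv -r\pmod d$. Put $$M=\frac{dp^s-p^s-r}{d},$$ which is a nonnegative integer. Write $(x)_0=1$ and $(x)_k=x(x+1)\cdots(x+k-1)$ for $k\ge 1$. Then, for $m=M$ and also for $m=p^s-1$, $$\sum_{k=0}^{m}(2dk+r)\frac{(r/d)_k^6}{k!^6}\equiv\frac{(2r/d)_{M}}{(1)_{M}}\sum_{k=0}^{M}\frac{(r/d)_k^3\,(1-r/d)_k}{k!^3\,(2r/d)_k}\left\{(d-1)p^s-(d-1)^3p^{3s}\sum_{j=1}^{k}\left(\frac{1}{(dj)^2}+\frac{1}{(dj-d+r)^2}\right)\right\}\pmod{p^{s+5}}.$$ Here, for rational numbers $x$ and $y$, the congruence $x\equiv y\pmod{p^N}$ means that $x-y=p^N\,a/b$ for some integers $a,b$ with $p\nmid b$. -/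

import Mathlib

open Finset
open scoped Nat

/-- The shifted factorial (Pochhammer symbol) `(x)_k = x (x + 1) ⋯ (x + k - 1)`, with `(x)_0 = 1`. -/
noncomputable def shiftedFactorial (x : ℚ) (k : ℕ) : ℚ :=
  (ascPochhammer ℚ k).eval x

/-- Congruence of rational numbers modulo `p ^ N`: `x - y` is `p ^ N` times a fraction
whose denominator is prime to `p`, i.e. `x - y ∈ p ^ N ℤ_(p)`. -/
def RatCongr (p N : ℕ) (x y : ℚ) : Prop :=
  ∃ a b : ℤ, ¬ (p : ℤ) ∣ b ∧ x - y = (p : ℚ) ^ N * ((a : ℚ) / (b : ℚ))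

/-- The natural number `(d n - n - r) / d`. For `n ≡ -r` modulo `d` and `r ≤ d n - n` the division
is exact and the integer is nonnegative, see `truncIndex_spec`. -/
def truncIndex (d n : ℕ) (r : ℤ) : ℕ :=
  (((d : ℤ) * (n : ℤ) - (n : ℤ) - r) / (d : ℤ)).toNat

theorem truncIndex_spec (d n : ℕ) (r : ℤ) (hd : 0 < d) (hr : r ≤ (d : ℤ) * n - n)
    (h : (n : ℤ) ≡ -r [ZMOD (d : ℤ)]) :
    (d : ℤ) * (truncIndex d n r : ℤ) = (d : ℤ) * n - n - r := by
  have hdvd : (d : ℤ) ∣ (d : ℤ) * n - n - r := by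
    have h1 := h.dvd
    have h2 : (d : ℤ) * n - n - r = (d : ℤ) * n + (-r - n) := by ring
    rw [h2]
    exact dvd_add (dvd_mul_right _ _) h1
  have hnn : (0 : ℤ) ≤ ((d : ℤ) * n - n - r) / (d : ℤ) :=
    Int.ediv_nonneg (by linarith) (by positivity)
  unfold truncIndex
  rw [Int.toNat_of_nonneg hnn, Int.mul_ediv_cancel' hdvd]

/-
Write `a = r / d`, `N = a + M = (d - 1) p ^ s / d`, and deform `∑ (a + 2 k) (a)_k ^ 6 / k! ^ 6` to
a very-well-poised sum `F(u, v)` by replacing two factors `((a)_k / k!)²` by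
`(a + u)_k (a - u)_k / ((1 + u)_k (1 - u)_k)` and likewise for `v`. Iterating Bailey's lemma
writes `F(u, v)` as a double sum whose coefficients do not involve `u` and `v` and are divisible
by `p ^ (s + 1)`. Since the deformation is even and `p² ∣ (N / i)²` for `0 < i < p ^ s`, each of
the two differences in `F(0, 0) - F(N, 0) - F(0, N) + F(N, N)` gains another factor `p²`, so
`F(0, 0) ≡ 2 F(N, 0) - F(N, N)` modulo `p ^ (s + 5)`. At `u = N` the factor `(a - u)_k = (-M)_k`
ends the series at `k = M`, and Whipple's transformation evaluates it as `N` times a sum whose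
terms, expanded to second order in `N`, give the right-hand side.
-/

local notation:max "⦅" x "⦆_" k:max => Polynomial.eval x (ascPochhammer _ k)

theorem sum_antidiagonal_antidiagonal_assoc {M : Type*} [AddCommMonoid M] (f : ℕ → ℕ → ℕ → M)
    (n : ℕ) :
    ∑ p ∈ antidiagonal n, ∑ q ∈ antidiagonal p.1, f q.1 q.2 p.2 =
      ∑ p ∈ antidiagonal n, ∑ q ∈ antidiagonal p.2, f p.1 q.1 q.2 := by
  simp only [sum_sigma']
  refine sum_nbij' (fun x ↦ ⟨(x.2.1, x.2.2 + x.1.2), (x.2.2, x.1.2)⟩)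
    (fun x ↦ ⟨(x.1.1 + x.2.1, x.2.2), (x.1.1, x.2.1)⟩) ?_ ?_ ?_ ?_ ?_ <;>
    grind [HasAntidiagonal.mem_antidiagonal]

section Hypergeometric

variable {R : Type*} [CommRing R]

theorem ascPochhammer_eval_add (x : R) (k l : ℕ) : ⦅x⦆_(k + l) = ⦅x⦆_k * ⦅x + k⦆_l := by
  simp [← ascPochhammer_mul]

theorem ascPochhammer_eval_succ_left (x : R) (k : ℕ) : ⦅x⦆_(k + 1) = x * ⦅x + 1⦆_k := by
  simp [ascPochhammer_succ_left]

theorem ascPochhammer_eval_eq_prod (x : R) (k : ℕ) : ⦅x⦆_k = ∏ i ∈ range k, (x + i) := by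
  induction k with
  | zero => simp
  | succ k ih => rw [ascPochhammer_succ_eval, prod_range_succ, ih]

theorem ascPochhammer_eval_reflect (x : R) (k : ℕ) : ⦅x⦆_k = (-1) ^ k * ⦅1 - x - k⦆_k := by
  rw [← neg_neg x, ascPochhammer_eval_neg_eq_descPochhammer, descPochhammer_eval_eq_ascPochhammer,
    sub_add_eq_add_sub, add_comm, sub_eq_add_neg 1, neg_neg]

theorem ascPochhammer_eval_neg_natCast_mul_factorial {k m : ℕ} (hk : k ≤ m) :
    ⦅-(m : R)⦆_k * (m - k)! = (-1) ^ k * m ! := by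
  rw [ascPochhammer_eval_neg_eq_descPochhammer, descPochhammer_eval_eq_descFactorial,
    ← Nat.factorial_mul_descFactorial hk, Nat.cast_mul]
  ring

theorem ascPochhammer_eval_ne_zero_of_le {x : R} {k l : ℕ} (hkl : k ≤ l) (h : ⦅x⦆_l ≠ 0) :
    ⦅x⦆_k ≠ 0 := by
  obtain ⟨j, rfl⟩ := Nat.exists_eq_add_of_le hkl
  exact left_ne_zero_of_mul (ascPochhammer_eval_add x k j ▸ h)

theorem add_mul_ascPochhammer_eval_add_one (x : R) (l j : ℕ) :
    (l + j : R) * ⦅x + 1⦆_j = l * ⦅x⦆_j + j * ((x + l + j) * ⦅x + 1⦆_(j - 1)) := by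
  cases j with
  | zero => simp
  | succ j =>
    rw [ascPochhammer_eval_succ_left x, ascPochhammer_succ_eval j, Nat.add_sub_cancel]
    push_cast
    ring

theorem ascPochhammer_eval_one_add_mul_sub_sub {a : R} {k M : ℕ} (hk : k ≤ M) :
    M ! * (⦅1 + a⦆_M * a) * (⦅1 - (a + M) - a⦆_(M - k) * ⦅2 * a⦆_k) =
      (M - k)! * ⦅1 - (a + M)⦆_M * ((a + M) * ⦅2 * a⦆_M * ⦅-(M : R)⦆_k) := by
  obtain ⟨l, rfl⟩ := Nat.exists_eq_add_of_le hk
  have hshift : ⦅1 + a⦆_(k + l) * a = (-1) ^ (k + l) * ⦅1 - (a + (k + l : ℕ))⦆_(k + l) *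
      (a + (k + l : ℕ)) := by
    rw [mul_comm, add_comm 1 a, ← ascPochhammer_eval_succ_left, ascPochhammer_succ_eval,
      ascPochhammer_eval_reflect, sub_sub]
  have hsplit : ⦅2 * a⦆_(k + l) = ⦅2 * a⦆_k * ((-1) ^ l * ⦅1 - (a + (k + l : ℕ)) - a⦆_l) := by
    rw [ascPochhammer_eval_add, ascPochhammer_eval_reflect (2 * a + k)]
    push_cast
    ring_nf
  have hfac := ascPochhammer_eval_neg_natCast_mul_factorial (R := R) hk
  rw [Nat.add_sub_cancel_left] at hfac ⊢
  rw [hshift, hsplit, pow_add]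
  linear_combination -((-1) ^ l * ⦅1 - (a + (k + l : ℕ))⦆_(k + l) * (a + (k + l : ℕ)) *
    ⦅1 - (a + (k + l : ℕ)) - a⦆_l * ⦅2 * a⦆_k) * hfac

variable {K : Type*} [Field K]

/-- The product `(x + u)_k (x - u)_k / k!²`: a symmetric deformation of `((x)_k / k!)²`, even in the
deformation parameter `u`. -/
noncomputable def symmPochhammer (x u : K) (k : ℕ) : K :=
  ⦅x + u⦆_k * ⦅x - u⦆_k / k ! ^ 2

theorem ascPochhammer_eval_add_mul_sub [CharZero K] (x u : K) (k : ℕ) :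
    ⦅x + u⦆_k * ⦅x - u⦆_k = k ! ^ 2 * symmPochhammer x u k := by
  have := k.factorial_ne_zero
  rw [symmPochhammer]
  field_simp

theorem symmPochhammer_zero_right (x : K) (k : ℕ) : symmPochhammer x 0 k = (⦅x⦆_k / k !) ^ 2 := by
  rw [symmPochhammer, add_zero, sub_zero, ← sq, div_pow]

/-- Partial sum of a very-well-poised hypergeometric series in `a` with two symmetric deformation
parameters. For `u = v = 0` its terms are `(a + 2 k) (a)_k ^ 6 / k! ^ 6`; the leading factor is not
normalised to `(a + 2 k) / a`. -/
noncomputable def vwpSum (a u v : K) (m : ℕ) : K :=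
  ∑ k ∈ range (m + 1), (a + 2 * k) * symmPochhammer a 0 k *
    (symmPochhammer a u k / symmPochhammer 1 u k) * (symmPochhammer a v k / symmPochhammer 1 v k)

theorem vwpSum_comm (a u v : K) (m : ℕ) : vwpSum a u v m = vwpSum a v u m :=
  sum_congr rfl fun _ _ ↦ mul_right_comm _ _ _

variable [CharZero K]

theorem symmPochhammer_ne_zero_of_le {x u : K} {k l : ℕ} (hkl : k ≤ l)
    (h : symmPochhammer x u l ≠ 0) : symmPochhammer x u k ≠ 0 := by
  have hl := (div_ne_zero_iff.mp h).1
  exact div_ne_zero (mul_ne_zero (ascPochhammer_eval_ne_zero_of_le hkl (left_ne_zero_of_mul hl))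
    (ascPochhammer_eval_ne_zero_of_le hkl (right_ne_zero_of_mul hl)))
    (pow_ne_zero 2 (Nat.cast_ne_zero.mpr k.factorial_ne_zero))

theorem pfaff_saalschuetz (A B C : K) (n : ℕ) :
    ∑ q ∈ antidiagonal n, ⦅A⦆_q.1 * ⦅B⦆_q.1 * ⦅C⦆_q.2 * ⦅A + B + C + q.1⦆_q.2 / (q.1 ! * q.2 !) =
      ⦅A + C⦆_n * ⦅B + C⦆_n / n ! := by
  induction n with
  | zero => simp
  | succ n ih =>
    set t : ℕ → ℕ → K :=
      fun l j ↦ ⦅A⦆_l * ⦅B⦆_l * ⦅C⦆_j * ⦅A + B + C + l⦆_j / (l ! * j !) with ht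
    set U : ℕ → ℕ → K := fun l j ↦ j * (⦅A⦆_l * ⦅B⦆_l * ⦅C⦆_j * (A + B + C + n + l) *
      ⦅A + B + C + l⦆_(j - 1) / (l ! * j !)) with hU
    set V : ℕ → ℕ → K := fun l j ↦ l * (⦅A⦆_l * ⦅B⦆_l * ⦅C⦆_j * ⦅A + B + C + l - 1⦆_j /
      (l ! * j !)) with hV
    have split {l j : ℕ} (h : l + j = n + 1) : (n + 1 : K) * t l j = V l j + U l j := by
      have hn : (n + 1 : K) = l + j := by exact_mod_cast h.symm
      have key := add_mul_ascPochhammer_eval_add_one (A + B + C + l - 1) l j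
      rw [sub_add_cancel,
        show A + B + C + l - 1 + l + j = A + B + C + n + l by linear_combination -hn] at key
      simp only [ht, hU, hV, hn]
      linear_combination ⦅A⦆_l * ⦅B⦆_l * ⦅C⦆_j / (l ! * j !) * key
    have shift {l j : ℕ} (h : l + j = n) :
        V (l + 1) j + U l (j + 1) = (A + C + n) * (B + C + n) * t l j := by
      have hn : (n : K) = l + j := by exact_mod_cast h.symm
      have hl : (l + 1 : K) ≠ 0 := l.cast_add_one_ne_zero
      have hj : (j + 1 : K) ≠ 0 := j.cast_add_one_ne_zero
      simp only [ht, hU, hV, hn, Nat.factorial_succ, ascPochhammer_succ_eval, Nat.cast_mul,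
        Nat.cast_succ, add_sub_cancel_right, ← add_assoc, Nat.add_sub_cancel]
      field_simp
      ring
    have recursion : (n + 1 : K) * ∑ q ∈ antidiagonal (n + 1), t q.1 q.2 =
        (A + C + n) * (B + C + n) * ∑ q ∈ antidiagonal n, t q.1 q.2 := by
      calc (n + 1 : K) * ∑ q ∈ antidiagonal (n + 1), t q.1 q.2
          = ∑ q ∈ antidiagonal (n + 1), (V q.1 q.2 + U q.1 q.2) := by
            rw [mul_sum]
            exact sum_congr rfl fun q hq ↦ split (mem_antidiagonal.mp hq)
        _ = ∑ q ∈ antidiagonal n, (V (q.1 + 1) q.2 + U q.1 (q.2 + 1)) := by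
            rw [sum_add_distrib, Nat.sum_antidiagonal_succ, Nat.sum_antidiagonal_succ',
              sum_add_distrib]
            simp [hU, hV]
        _ = _ := by
            rw [mul_sum]
            exact sum_congr rfl fun q hq ↦ shift (mem_antidiagonal.mp hq)
    rw [ih] at recursion
    rw [Nat.factorial_succ, ascPochhammer_succ_eval, ascPochhammer_succ_eval]
    have hn : (n + 1 : K) ≠ 0 := n.cast_add_one_ne_zero
    have := n.factorial_ne_zero
    push_cast
    field_simp at recursion ⊢
    linear_combination recursion

/-- The factor that a pair of parameters `b`, `c` contributes to the `k`-th term of a hypergeometric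
series well poised in `a`. -/
noncomputable def wellPoised (a b c : K) (k : ℕ) : K :=
  ⦅b⦆_k * ⦅c⦆_k / (⦅1 + a - b⦆_k * ⦅1 + a - c⦆_k)

/-- The sequence `β` of the Bailey pair relative to `a` with first component `α`, in the limit
`q → 1`. -/
noncomputable def baileyBeta (a : K) (α : ℕ → K) (L : ℕ) : K :=
  ∑ q ∈ antidiagonal L, α q.1 / (q.2 ! * ⦅1 + a⦆_(L + q.1))

theorem sum_antidiagonal_mul_ascPochhammer_eval_div {a : K} (ha : ∀ k, ⦅1 + a⦆_k ≠ 0) (ρ σ : K)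
    (k n : ℕ) :
    ∑ q ∈ antidiagonal n, ⦅ρ⦆_(k + q.1) * ⦅σ⦆_(k + q.1) * ⦅1 + a - ρ - σ⦆_q.2 /
        (q.1 ! * q.2 ! * ⦅1 + a⦆_(k + q.1 + k)) =
      ⦅ρ⦆_k * ⦅σ⦆_k / ⦅1 + a⦆_(k + n + k) * (⦅1 + a - ρ + k⦆_n * ⦅1 + a - σ + k⦆_n / n !) := by
  have saalschuetz := pfaff_saalschuetz (ρ + k) (σ + k) (1 + a - ρ - σ) n
  rw [show ρ + k + (σ + k) + (1 + a - ρ - σ) = 1 + a + (k + k : ℕ) by push_cast; ring,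
    show ρ + k + (1 + a - ρ - σ) = 1 + a - σ + k by ring,
    show σ + k + (1 + a - ρ - σ) = 1 + a - ρ + k by ring] at saalschuetz
  rw [mul_comm ⦅1 + a - ρ + k⦆_n, ← saalschuetz, mul_sum]
  refine sum_congr rfl fun ⟨l, j⟩ hq ↦ ?_
  have hlj : k + n + k = k + l + k + j := by have := mem_antidiagonal.mp hq; omega
  have h : ⦅1 + a⦆_(k + n + k) = ⦅1 + a⦆_(k + l + k) * ⦅1 + a + (k + k : ℕ) + l⦆_j := by
    rw [hlj, ascPochhammer_eval_add]
    push_cast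
    ring_nf
  have h₁ := ha (k + l + k)
  have h₂ : ⦅1 + a + (k + k : ℕ) + l⦆_j ≠ 0 := right_ne_zero_of_mul (h ▸ ha (k + n + k))
  have := l.factorial_ne_zero
  have := j.factorial_ne_zero
  simp only [h, ascPochhammer_eval_add ρ, ascPochhammer_eval_add σ]
  field_simp

theorem baileyBeta_wellPoised_mul {a ρ σ : K} (α : ℕ → K) {m : ℕ} (ha : ∀ k, ⦅1 + a⦆_k ≠ 0)
    (hρ : ⦅1 + a - ρ⦆_m ≠ 0) (hσ : ⦅1 + a - σ⦆_m ≠ 0) :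
    baileyBeta a (fun k ↦ wellPoised a ρ σ k * α k) m =
      ∑ q ∈ antidiagonal m, ⦅ρ⦆_q.1 * ⦅σ⦆_q.1 * ⦅1 + a - ρ - σ⦆_q.2 /
        (q.2 ! * ⦅1 + a - ρ⦆_m * ⦅1 + a - σ⦆_m) * baileyBeta a α q.1 := by
  set g : ℕ → ℕ → ℕ → K := fun k l j ↦ α k / (⦅1 + a - ρ⦆_m * ⦅1 + a - σ⦆_m) *
    (⦅ρ⦆_(k + l) * ⦅σ⦆_(k + l) * ⦅1 + a - ρ - σ⦆_j / (l ! * j ! * ⦅1 + a⦆_(k + l + k))) with hg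
  calc baileyBeta a (fun k ↦ wellPoised a ρ σ k * α k) m
      = ∑ p ∈ antidiagonal m, ∑ q ∈ antidiagonal p.2, g p.1 q.1 q.2 := by
        refine sum_congr rfl fun ⟨k, n⟩ hp ↦ ?_
        obtain rfl : k + n = m := mem_antidiagonal.mp hp
        simp only [hg, ← mul_sum, sum_antidiagonal_mul_ascPochhammer_eval_div ha, wellPoised]
        rw [ascPochhammer_eval_add] at hρ hσ
        rw [ascPochhammer_eval_add (1 + a - ρ), ascPochhammer_eval_add (1 + a - σ)]
        have := left_ne_zero_of_mul hρ
        have := right_ne_zero_of_mul hρ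
        have := left_ne_zero_of_mul hσ
        have := right_ne_zero_of_mul hσ
        have := ha (k + n + k)
        have := n.factorial_ne_zero
        field_simp
    _ = ∑ p ∈ antidiagonal m, ∑ q ∈ antidiagonal p.1, g q.1 q.2 p.2 :=
        (sum_antidiagonal_antidiagonal_assoc g m).symm
    _ = _ := by
        refine sum_congr rfl fun ⟨L, j⟩ _ ↦ ?_
        rw [baileyBeta, mul_sum]
        refine sum_congr rfl fun ⟨k, l⟩ hq ↦ ?_
        obtain rfl : k + l = L := mem_antidiagonal.mp hq
        simp only [hg]
        ring

/-- The sequence `α` of the unit Bailey pair relative to `a`, in the limit `q → 1` and multiplied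
by `a`. -/
noncomputable def unitAlpha (a : K) (k : ℕ) : K :=
  (-1) ^ k * (a + 2 * k) * ⦅a⦆_k / k !

theorem sum_range_unitAlpha_div {a : K} (ha : ∀ k, ⦅1 + a⦆_k ≠ 0) {k L : ℕ} (hL : L ≠ 0)
    (hk : k ≤ L) :
    ∑ i ∈ range (k + 1), unitAlpha a i / ((L - i)! * ⦅1 + a⦆_(L + i)) =
      (-1) ^ k * ⦅a⦆_(k + 1) * (L - k) / (k ! * L * (L - k)! * ⦅1 + a⦆_(L + k)) := by
  have hL' : (L : K) ≠ 0 := by exact_mod_cast hL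
  induction k with
  | zero =>
    have := ha L
    have := L.factorial_ne_zero
    simp only [unitAlpha, zero_add, range_one, sum_singleton, pow_zero, ascPochhammer_zero,
      ascPochhammer_one, Polynomial.eval_one, Polynomial.eval_X, Nat.factorial_zero, Nat.sub_zero,
      add_zero, Nat.cast_zero, Nat.cast_one, sub_zero]
    field_simp
    ring
  | succ k ih =>
    have hfac : ((L - k)! : K) = (L - k) * (L - (k + 1))! := by
      rw [show L - k = L - (k + 1) + 1 by omega, Nat.factorial_succ]
      push_cast [Nat.cast_sub hk]
      ring
    have hLk : (L - k : K) ≠ 0 := sub_ne_zero.mpr (by exact_mod_cast (by omega : L ≠ k))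
    have hP : ⦅1 + a⦆_(L + (k + 1)) = ⦅1 + a⦆_(L + k) * (1 + a + L + k) := by
      rw [← add_assoc, ascPochhammer_succ_eval]
      push_cast
      ring
    have h₁ := ha (L + k)
    have h₂ : 1 + a + L + k ≠ 0 := right_ne_zero_of_mul (hP ▸ ha (L + (k + 1)))
    have h₃ : (k + 1 : K) ≠ 0 := k.cast_add_one_ne_zero
    have := k.factorial_ne_zero
    have := (L - (k + 1)).factorial_ne_zero
    rw [sum_range_succ, ih (by omega), hfac, hP, unitAlpha, ascPochhammer_succ_eval (k + 1),
      Nat.factorial_succ]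
    push_cast
    field_simp
    ring

theorem baileyBeta_unitAlpha {a : K} (ha : ∀ k, ⦅1 + a⦆_k ≠ 0) (L : ℕ) :
    baileyBeta a (unitAlpha a) L = if L = 0 then a else 0 := by
  split_ifs with hL
  · simp [hL, baileyBeta, unitAlpha]
  · rw [baileyBeta, Nat.sum_antidiagonal_eq_sum_range_succ
      (fun k l ↦ unitAlpha a k / (l ! * ⦅1 + a⦆_(L + k))), sum_range_unitAlpha_div ha hL le_rfl]
    simp

theorem baileyBeta_wellPoised_mul_unitAlpha {a b c : K} {L : ℕ} (ha : ∀ k, ⦅1 + a⦆_k ≠ 0)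
    (hb : ⦅1 + a - b⦆_L ≠ 0) (hc : ⦅1 + a - c⦆_L ≠ 0) :
    baileyBeta a (fun k ↦ wellPoised a b c k * unitAlpha a k) L =
      a * (⦅1 + a - b - c⦆_L / (L ! * ⦅1 + a - b⦆_L * ⦅1 + a - c⦆_L)) := by
  rw [baileyBeta_wellPoised_mul _ ha hb hc, sum_eq_single (0, L)]
  · simp [baileyBeta_unitAlpha ha, mul_comm]
  · rintro ⟨j, l⟩ hq hj
    have hj0 : j ≠ 0 := by
      rintro rfl
      exact hj (by simpa using hq)
    simp [baileyBeta_unitAlpha ha, hj0]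
  · simp

theorem baileyBeta_wellPoised_mul_wellPoised_mul_unitAlpha {a b c d e : K} {L : ℕ}
    (ha : ∀ k, ⦅1 + a⦆_k ≠ 0) (hb : ⦅1 + a - b⦆_L ≠ 0) (hc : ⦅1 + a - c⦆_L ≠ 0)
    (hd : ⦅1 + a - d⦆_L ≠ 0) (he : ⦅1 + a - e⦆_L ≠ 0) :
    baileyBeta a (fun k ↦ wellPoised a d e k * (wellPoised a b c k * unitAlpha a k)) L =
      ∑ q ∈ antidiagonal L,
        ⦅d⦆_q.1 * ⦅e⦆_q.1 * ⦅1 + a - d - e⦆_q.2 / (q.2 ! * ⦅1 + a - d⦆_L * ⦅1 + a - e⦆_L) *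
          (a * (⦅1 + a - b - c⦆_q.1 / (q.1 ! * ⦅1 + a - b⦆_q.1 * ⦅1 + a - c⦆_q.1))) := by
  rw [baileyBeta_wellPoised_mul _ ha hd he]
  refine sum_congr rfl fun q hq ↦ ?_
  have hqL := HasAntidiagonal.antidiagonal.fst_le hq
  rw [baileyBeta_wellPoised_mul_unitAlpha ha (ascPochhammer_eval_ne_zero_of_le hqL hb)
    (ascPochhammer_eval_ne_zero_of_le hqL hc)]

theorem factorial_mul_baileyBeta {a : K} (α : ℕ → K) (m : ℕ) (ha : ∀ k, ⦅1 + a⦆_k ≠ 0) :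
    m ! * ⦅1 + a⦆_m * baileyBeta a α m =
      ∑ k ∈ range (m + 1), (-1) ^ k * (⦅-(m : K)⦆_k / ⦅1 + a + m⦆_k) * α k := by
  rw [baileyBeta, Nat.sum_antidiagonal_eq_sum_range_succ
    (fun k l ↦ α k / (l ! * ⦅1 + a⦆_(m + k))), mul_sum]
  refine sum_congr rfl fun k hk ↦ ?_
  have hfac := ascPochhammer_eval_neg_natCast_mul_factorial (R := K)
    (Nat.lt_succ_iff.mp (mem_range.mp hk))
  have hsign : ((-1) ^ k * (-1) ^ k : K) = 1 := by rw [← mul_pow]; simp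
  have hP := ha (m + k)
  rw [ascPochhammer_eval_add] at hP ⊢
  have := left_ne_zero_of_mul hP
  have := right_ne_zero_of_mul hP
  have := (m - k).factorial_ne_zero
  field_simp
  linear_combination -(α k * m !) * hsign - (α k * (-1) ^ k) * hfac

theorem sum_range_eq_sum_baileyBeta {a f : K} (α : ℕ → K) {m : ℕ} (ha : ∀ k, ⦅1 + a⦆_k ≠ 0)
    (hf : ⦅1 + a - f⦆_m ≠ 0) :
    ∑ k ∈ range (m + 1), (-1) ^ k * (⦅f⦆_k / ⦅1 + a - f⦆_k) * α k =
      ⦅1 + a⦆_m / ⦅1 + a - f⦆_m * ∑ q ∈ antidiagonal m, (-1) ^ q.1 * ⦅f⦆_q.1 *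
        ⦅1 + a + m⦆_q.1 * (⦅1 + f + q.1⦆_q.2 / q.2 !) * baileyBeta a α q.1 := by
  have hσ : 1 + a - (1 + a + m) = -m := by ring
  have hm : ⦅-(m : K)⦆_m = (-1) ^ m * m ! := by
    simpa using ascPochhammer_eval_neg_natCast_mul_factorial (R := K) (le_refl m)
  have hm0 : ⦅-(m : K)⦆_m ≠ 0 := by simp [hm, m.factorial_ne_zero]
  calc ∑ k ∈ range (m + 1), (-1) ^ k * (⦅f⦆_k / ⦅1 + a - f⦆_k) * α k
      = m ! * ⦅1 + a⦆_m * baileyBeta a (fun k ↦ wellPoised a f (1 + a + m) k * α k) m := by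
        rw [factorial_mul_baileyBeta _ _ ha]
        refine sum_congr rfl fun k hk ↦ ?_
        have hk0 := ascPochhammer_eval_ne_zero_of_le (Nat.lt_succ_iff.mp (mem_range.mp hk)) hm0
        have hP := ha (m + k)
        rw [ascPochhammer_eval_add] at hP
        have := right_ne_zero_of_mul hP
        rw [wellPoised, hσ]
        field_simp
    _ = _ := by
        rw [baileyBeta_wellPoised_mul _ ha hf (hσ ▸ hm0), mul_sum, mul_sum]
        refine sum_congr rfl fun ⟨L, j⟩ hq ↦ ?_
        have hLj : L + j = m := mem_antidiagonal.mp hq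
        have hm' : (m : K) = L + j := by exact_mod_cast hLj.symm
        have hsign : ((-1) ^ m : K) = (-1) ^ L * (-1) ^ j := by rw [← hLj, pow_add]
        have hrefl : ⦅1 + a - f - (1 + a + m)⦆_j = (-1) ^ j * ⦅1 + f + L⦆_j := by
          rw [ascPochhammer_eval_reflect, hm']
          ring_nf
        have hL1 : ((-1) ^ L * (-1) ^ L : K) = 1 := by rw [← mul_pow]; simp
        have := m.factorial_ne_zero
        have := j.factorial_ne_zero
        rw [hσ, hm, hrefl, hsign]
        field_simp
        linear_combination
          -(⦅1 + a⦆_m * ⦅f⦆_L * baileyBeta a α L * ⦅1 + a + m⦆_L * ⦅1 + f + L⦆_j) * hL1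

theorem symmPochhammer_one_zero (k : ℕ) : symmPochhammer (1 : K) 0 k = 1 := by
  rw [symmPochhammer_zero_right, ascPochhammer_eval_one,
    div_self (Nat.cast_ne_zero.mpr k.factorial_ne_zero), one_pow]

theorem wellPoised_add_sub (a u : K) (k : ℕ) :
    wellPoised a (a + u) (a - u) k = symmPochhammer a u k / symmPochhammer 1 u k := by
  have := k.factorial_ne_zero
  rw [wellPoised, symmPochhammer, symmPochhammer, show 1 + a - (a + u) = 1 - u by ring,
    show 1 + a - (a - u) = 1 + u by ring]
  field_simp

/-- The coefficients, free of `u` and `v`, of the double sum into which iterating Bailey's lemma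
expands `vwpSum a u v m`. The indices are meant to satisfy `q.1 + q.2 = m` and
`t.1 + t.2 = q.1`. -/
noncomputable def vwpCoeff (a : K) (m : ℕ) (q t : ℕ × ℕ) : K :=
  (-1) ^ q.1 * (⦅a⦆_(m + 1) / m !) * (⦅a⦆_q.1 / q.1 !) * (⦅1 + a + m⦆_q.1 / q.1 !) *
    (⦅1 + a + q.1⦆_q.2 / q.2 !) * (⦅1 - a⦆_t.1 / t.1 !) * (⦅1 - a⦆_t.2 / t.2 !)

theorem baileyBeta_symm {a u v : K} {L : ℕ} (ha : ∀ k, ⦅1 + a⦆_k ≠ 0)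
    (hu : symmPochhammer 1 u L ≠ 0) (hv : symmPochhammer 1 v L ≠ 0) :
    baileyBeta a (fun k ↦
        wellPoised a (a + v) (a - v) k * (wellPoised a (a + u) (a - u) k * unitAlpha a k)) L =
      a / L ! ^ 2 * ∑ t ∈ antidiagonal L, ⦅1 - a⦆_t.1 / t.1 ! * (⦅1 - a⦆_t.2 / t.2 !) *
        (symmPochhammer a v t.1 / symmPochhammer 1 v L) * (symmPochhammer 1 u t.1)⁻¹ := by
  have h₁ (x : K) : 1 + a - (a + x) = 1 - x := by ring
  have h₂ (x : K) : 1 + a - (a - x) = 1 + x := by ring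
  have h₃ (x : K) : 1 - x - (a - x) = 1 - a := by ring
  have hswap (x : K) (k : ℕ) : ⦅1 - x⦆_k * ⦅1 + x⦆_k = k ! ^ 2 * symmPochhammer 1 x k := by
    rw [mul_comm, ascPochhammer_eval_add_mul_sub]
  have hu' := (div_ne_zero_iff.mp hu).1
  have hv' := (div_ne_zero_iff.mp hv).1
  rw [baileyBeta_wellPoised_mul_wellPoised_mul_unitAlpha ha
    (h₁ u ▸ right_ne_zero_of_mul hu') (h₂ u ▸ left_ne_zero_of_mul hu')
    (h₁ v ▸ right_ne_zero_of_mul hv') (h₂ v ▸ left_ne_zero_of_mul hv'), mul_sum]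
  refine sum_congr rfl fun ⟨j, l⟩ _ ↦ ?_
  have := j.factorial_ne_zero
  simp only [h₁, h₂, h₃, ascPochhammer_eval_add_mul_sub, mul_assoc, hswap]
  generalize symmPochhammer a v j = A, symmPochhammer 1 v L = B, symmPochhammer 1 u j = C
  field_simp

theorem vwpSum_eq_sum_vwpCoeff {a u v : K} (m : ℕ) (ha : ∀ k, ⦅1 + a⦆_k ≠ 0)
    (hu : symmPochhammer 1 u m ≠ 0) (hv : symmPochhammer 1 v m ≠ 0) :
    vwpSum a u v m = ∑ q ∈ antidiagonal m, ∑ t ∈ antidiagonal q.1,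
      vwpCoeff a m q t * (symmPochhammer a v t.1 / symmPochhammer 1 v q.1) *
        (symmPochhammer 1 u t.1)⁻¹ := by
  calc vwpSum a u v m
      = ∑ k ∈ range (m + 1), (-1) ^ k * (⦅a⦆_k / ⦅1 + a - a⦆_k) *
          (wellPoised a (a + v) (a - v) k * (wellPoised a (a + u) (a - u) k * unitAlpha a k)) := by
        refine sum_congr rfl fun k _ ↦ ?_
        have hsign : ((-1) ^ k * (-1) ^ k : K) = 1 := by rw [← mul_pow]; simp
        rw [wellPoised_add_sub, wellPoised_add_sub, symmPochhammer_zero_right, unitAlpha,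
          add_sub_cancel_right, ascPochhammer_eval_one]
        linear_combination -((a + 2 * k) * (⦅a⦆_k / k !) ^ 2 *
          (symmPochhammer a u k / symmPochhammer 1 u k) *
          (symmPochhammer a v k / symmPochhammer 1 v k)) * hsign
    _ = _ := by
        rw [sum_range_eq_sum_baileyBeta _ ha (by simp [m.factorial_ne_zero]), mul_sum]
        refine sum_congr rfl fun ⟨L, n⟩ hq ↦ ?_
        have hLm : L ≤ m := HasAntidiagonal.antidiagonal.fst_le hq
        rw [baileyBeta_symm ha (symmPochhammer_ne_zero_of_le hLm hu)
          (symmPochhammer_ne_zero_of_le hLm hv), ← mul_assoc, ← mul_assoc, mul_sum]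
        refine sum_congr rfl fun ⟨j, l⟩ _ ↦ ?_
        rw [vwpCoeff, add_sub_cancel_right, ascPochhammer_eval_one, ascPochhammer_eval_succ_left,
          add_comm a 1]
        ring

theorem vwpSum_add_natCast_eq_baileyBeta {a v : K} {m M : ℕ} (hMm : M ≤ m)
    (ha : ∀ k, ⦅1 + a⦆_k ≠ 0) :
    vwpSum a (a + M) v m = M ! * ⦅1 + a⦆_M * baileyBeta a (fun k ↦
      wellPoised a (a + (a + M)) a k * (wellPoised a (a + v) (a - v) k * unitAlpha a k)) M := by
  have hM : a - (a + M) = -M := by ring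
  have truncated : vwpSum a (a + M) v m = vwpSum a (a + M) v M := by
    refine (sum_subset (range_subset_range.mpr (by omega)) fun k _ hk ↦ ?_).symm
    rw [symmPochhammer.eq_1 a (a + M), hM,
      ascPochhammer_eval_neg_coe_nat_of_lt (by simpa using hk)]
    simp
  rw [truncated, factorial_mul_baileyBeta _ _ ha]
  refine sum_congr rfl fun k _ ↦ ?_
  have hsign : ((-1) ^ k * (-1) ^ k : K) = 1 := by rw [← mul_pow]; simp
  have hk : (k ! ^ 2 : K) ≠ 0 := pow_ne_zero 2 (Nat.cast_ne_zero.mpr k.factorial_ne_zero)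
  rw [wellPoised_add_sub, wellPoised, symmPochhammer_zero_right, symmPochhammer.eq_1 a (a + M),
    symmPochhammer.eq_1 1 (a + M), div_div_div_cancel_right₀ hk, hM, unitAlpha,
    show 1 + a - (a + (a + M)) = 1 - (a + M) by ring, add_sub_cancel_right,
    ascPochhammer_eval_one, ← add_assoc 1 a]
  generalize symmPochhammer a v k / symmPochhammer 1 v k = V
  simp only [div_eq_mul_inv, mul_inv]
  linear_combination -((a + 2 * k) * ⦅a⦆_k ^ 2 * (k ! : K)⁻¹ ^ 2 * ⦅a + (a + M)⦆_k *
    ⦅-(M : K)⦆_k * (⦅1 + a + M⦆_k)⁻¹ * (⦅1 - (a + M)⦆_k)⁻¹ * V) * hsign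

theorem vwpSum_add_natCast {a v : K} {m M : ℕ} (hMm : M ≤ m) (ha : ∀ k, ⦅1 + a⦆_k ≠ 0)
    (ha2 : ∀ k, ⦅2 * a⦆_k ≠ 0) (hu : symmPochhammer 1 (a + M) M ≠ 0)
    (hv : symmPochhammer 1 v M ≠ 0) :
    vwpSum a (a + M) v m = (a + M) * (⦅2 * a⦆_M / M !) * ∑ k ∈ range (M + 1),
      ⦅1 - a⦆_k * ⦅a⦆_k / (k ! * ⦅2 * a⦆_k) *
        (symmPochhammer a (a + M) k / symmPochhammer 1 v k) := by
  have eu : 1 + a - (a + (a + M)) = 1 - (a + M) := by ring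
  have ev : 1 + a - (a + v) = 1 - v := by ring
  have ev' : 1 + a - (a - v) = 1 + v := by ring
  have hu' := right_ne_zero_of_mul (div_ne_zero_iff.mp hu).1
  have hv' := (div_ne_zero_iff.mp hv).1
  rw [vwpSum_add_natCast_eq_baileyBeta hMm ha,
    baileyBeta_wellPoised_mul_wellPoised_mul_unitAlpha ha (ev ▸ right_ne_zero_of_mul hv')
      (ev' ▸ left_ne_zero_of_mul hv') (eu ▸ hu') (by simp [M.factorial_ne_zero]),
    Nat.sum_antidiagonal_eq_sum_range_succ_mk, mul_sum, mul_sum]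
  refine sum_congr rfl fun k hk ↦ ?_
  have ratio := ascPochhammer_eval_one_add_mul_sub_sub (a := a)
    (Nat.lt_succ_iff.mp (mem_range.mp hk))
  have hv'' : ⦅1 - v⦆_k * ⦅1 + v⦆_k = k ! ^ 2 * symmPochhammer 1 v k := by
    rw [mul_comm, ascPochhammer_eval_add_mul_sub]
  have := k.factorial_ne_zero
  have := M.factorial_ne_zero
  have := (M - k).factorial_ne_zero
  have := ha2 k
  simp only [eu, ev, ev', mul_assoc, hv'', symmPochhammer.eq_1 a (a + M), add_sub_cancel_right,
    ascPochhammer_eval_one, show a - (a + M) = -M by ring, show 1 - v - (a - v) = 1 - a by ring]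
  generalize symmPochhammer 1 v k = V
  generalize ⦅2 * a⦆_M = S at ratio ⊢
  generalize ⦅2 * a⦆_k = T at this ratio ⊢
  field_simp
  linear_combination (⦅a + (a + M)⦆_k * ⦅a⦆_k * ⦅1 - a⦆_k * V⁻¹) * ratio

end Hypergeometric

theorem symmPochhammer_eq_mul_prod {K : Type*} [Field K] {x : K} {k : ℕ}
    (hx : ∀ i < k, x + i ≠ 0) (u : K) :
    symmPochhammer x u k = symmPochhammer x 0 k * ∏ i ∈ range k, (1 - (u / (x + i)) ^ 2) := by
  have hfactor : ∀ i ∈ range k,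
      (x + u + i) * (x - u + i) = (x + i) ^ 2 * (1 - (u / (x + i)) ^ 2) := fun i hi ↦ by
    have := hx i (mem_range.mp hi)
    field_simp
    ring
  rw [symmPochhammer_zero_right, symmPochhammer, ascPochhammer_eval_eq_prod,
    ascPochhammer_eval_eq_prod, ascPochhammer_eval_eq_prod, ← prod_mul_distrib,
    prod_congr rfl hfactor, prod_mul_distrib, prod_pow]
  ring

theorem symmPochhammer_one_eq_prod {K : Type*} [Field K] [CharZero K] (u : K) (k : ℕ) :
    symmPochhammer 1 u k = ∏ i ∈ range k, (1 - (u / (1 + i)) ^ 2) := by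
  rw [symmPochhammer_eq_mul_prod (fun i _ ↦ by rw [add_comm]; exact i.cast_add_one_ne_zero),
    symmPochhammer_one_zero, one_mul]

theorem ascPochhammer_eval_ne_zero_of_forall_ne_intCast {K : Type*} [Field K] {x : K}
    (hx : ∀ z : ℤ, x ≠ z) (k : ℕ) : ⦅x⦆_k ≠ 0 := by
  rw [ascPochhammer_eval_eq_prod]
  exact prod_ne_zero_iff.mpr fun i _ h ↦ hx (-i) (by push_cast; exact eq_neg_of_add_eq_zero_left h)

theorem le_of_not_dvd_choose {p m M : ℕ} (h : ¬ p ∣ m.choose M) : M ≤ m :=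
  le_of_not_gt fun hlt ↦ h (Nat.choose_eq_zero_of_lt hlt ▸ dvd_zero p)

/-- The fractional ideal `p ^ m ℤ_(p)` of `ℚ`, as an additive subgroup: the rationals of `p`-adic
norm at most `p ^ (-m)`. The congruences modulo `p ^ m` are memberships of differences in it. -/
noncomputable def padicIdeal (p : ℕ) [Fact p.Prime] (m : ℕ) : AddSubgroup ℚ where
  carrier := {x | ‖(x : ℚ_[p])‖ ≤ (p : ℝ) ^ (-m : ℤ)}
  zero_mem' := by
    simp
  add_mem' {x y} hx hy := by
    have := (Padic.nonarchimedean (x : ℚ_[p]) y).trans (max_le hx hy)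
    exact_mod_cast this
  neg_mem' {x} hx := by simpa using hx

instance (p : ℕ) [Fact p.Prime] : SetLike.GradedMonoid (padicIdeal p) where
  one_mem := by simp [padicIdeal]
  mul_mem m n x y hx hy := by
    have hp : (p : ℝ) ≠ 0 := by exact_mod_cast (Fact.out : p.Prime).ne_zero
    change ‖((x * y : ℚ) : ℚ_[p])‖ ≤ (p : ℝ) ^ (-(m + n : ℕ) : ℤ)
    rw [Rat.cast_mul, norm_mul, Nat.cast_add, neg_add, zpow_add₀ hp]
    exact mul_le_mul hx hy (norm_nonneg _) (by positivity)

namespace padicIdeal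

variable {p : ℕ} [Fact p.Prime] {m s : ℕ} {x y : ℚ}

theorem mem_iff : x ∈ padicIdeal p m ↔ ‖(x : ℚ_[p])‖ ≤ (p : ℝ) ^ (-m : ℤ) :=
  Iff.rfl

theorem mem_zero_iff : x ∈ padicIdeal p 0 ↔ ‖(x : ℚ_[p])‖ ≤ 1 := by
  simp [mem_iff]

theorem mem_one_iff : x ∈ padicIdeal p 1 ↔ ‖(x : ℚ_[p])‖ < 1 := by
  rw [mem_iff, Padic.norm_le_pow_iff_norm_lt_pow_add_one]
  simp

theorem antitone : Antitone (padicIdeal p) := fun _ _ hmn _ hx ↦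
  (mem_iff.mp hx).trans <| zpow_le_zpow_right₀
    (by exact_mod_cast (Fact.out : p.Prime).one_le) (by omega)

theorem mul_left_mem (hx : x ∈ padicIdeal p 0) (hy : y ∈ padicIdeal p m) :
    x * y ∈ padicIdeal p m :=
  zero_add m ▸ SetLike.mul_mem_graded hx hy

theorem mul_right_mem (hx : x ∈ padicIdeal p m) (hy : y ∈ padicIdeal p 0) :
    x * y ∈ padicIdeal p m :=
  add_zero m ▸ SetLike.mul_mem_graded hx hy

theorem natCast_mem (k : ℕ) : (k : ℚ) ∈ padicIdeal p 0 :=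
  SetLike.natCast_mem_graded _ k

theorem prime_pow_mem (m : ℕ) : (p : ℚ) ^ m ∈ padicIdeal p m := by
  simp [mem_iff]

theorem inv_natCast_mem {t : ℕ} (ht : ¬ p ∣ t) : (t : ℚ)⁻¹ ∈ padicIdeal p 0 := by
  have := Padic.norm_natCast_eq_one_iff.mpr (((Fact.out : p.Prime).coprime_iff_not_dvd).mpr ht)
  simp [mem_zero_iff, this]

theorem mem_of_natCast_mul_mem {t : ℕ} (ht : ¬ p ∣ t) (h : t * x ∈ padicIdeal p m) :
    x ∈ padicIdeal p m := by
  have ht0 : (t : ℚ) ≠ 0 := Nat.cast_ne_zero.mpr fun h₀ ↦ ht (h₀ ▸ dvd_zero p)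
  exact inv_mul_cancel_left₀ ht0 x ▸ mul_left_mem (inv_natCast_mem ht) h

theorem ratCongr_of_sub_mem (h : x - y ∈ padicIdeal p m) : RatCongr p m x y := by
  have hp : (p : ℚ) ≠ 0 := by exact_mod_cast (Fact.out : p.Prime).ne_zero
  set q : ℚ := (x - y) / p ^ m with hq
  have hq1 : ‖(q : ℚ_[p])‖ ≤ 1 := by
    have hpR : (0 : ℝ) < (p : ℝ) ^ (-m : ℤ) :=
      zpow_pos (by exact_mod_cast (Fact.out : p.Prime).pos) _
    rw [hq, Rat.cast_div, Rat.cast_pow, Rat.cast_natCast, norm_div, Padic.norm_p_pow]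
    exact (div_le_one hpR).mpr h
  refine ⟨q.num, q.den, ?_, ?_⟩
  · have hunit := PadicInt.isUnit_iff.mp (PadicInt.isUnit_den q hq1)
    rw [← PadicInt.norm_int_lt_one_iff_dvd, Int.cast_natCast, hunit]
    exact lt_irrefl 1
  · rw [Int.cast_natCast, Rat.num_div_den, hq, mul_div_cancel₀ _ (pow_ne_zero m hp)]

theorem div_natCast_mem {t : ℕ} (hx : x ∈ padicIdeal p s) (ht : 0 < t) (hts : t < p ^ s) :
    x / t ∈ padicIdeal p 1 := by
  have hnorm : ‖(x : ℚ_[p])‖ < ‖(t : ℚ_[p])‖ := by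
    refine (mem_iff.mp hx).trans_lt (lt_of_not_ge fun h ↦ ?_)
    have := (Padic.norm_int_le_pow_iff_dvd (p := p) t s).mp (by exact_mod_cast h)
    exact (Nat.le_of_dvd ht (by exact_mod_cast this)).not_gt hts
  rw [mem_one_iff, Rat.cast_div, Rat.cast_natCast, norm_div]
  exact (div_lt_one (hnorm.trans_le' (norm_nonneg _))).mpr hnorm

theorem one_mem : (1 : ℚ) ∈ padicIdeal p 0 :=
  SetLike.one_mem_graded _

theorem mem_zero_of_sub_one_mem (hx : x - 1 ∈ padicIdeal p m) : x ∈ padicIdeal p 0 :=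
  sub_add_cancel x 1 ▸ add_mem (antitone m.zero_le hx) one_mem

theorem norm_eq_one_of_sub_one_mem (hx : x - 1 ∈ padicIdeal p 1) : ‖(x : ℚ_[p])‖ = 1 := by
  have hlt : ‖(x - 1 : ℚ_[p])‖ < ‖(1 : ℚ_[p])‖ := by simpa using mem_one_iff.mp hx
  rw [← sub_add_cancel (x : ℚ_[p]) 1, Padic.add_eq_max_of_ne hlt.ne, max_eq_right hlt.le, norm_one]

theorem ne_zero_of_sub_one_mem (hx : x - 1 ∈ padicIdeal p 1) : x ≠ 0 := by
  rintro rfl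
  simpa using norm_eq_one_of_sub_one_mem hx

theorem inv_mem_of_sub_one_mem (hx : x - 1 ∈ padicIdeal p 1) : x⁻¹ ∈ padicIdeal p 0 := by
  simp [mem_zero_iff, norm_eq_one_of_sub_one_mem hx]

theorem ascPochhammer_eval_div_factorial_mem (hx : x ∈ padicIdeal p 0) (k : ℕ) :
    ⦅x⦆_k / k ! ∈ padicIdeal p 0 := by
  obtain ⟨z, hz⟩ : ∃ z : ℤ_[p], (z : ℚ_[p]) = x := ⟨⟨x, mem_zero_iff.mp hx⟩, rfl⟩
  have hfactor (i : ℕ) : ((x + i : ℚ) : ℚ_[p]) = PadicInt.Coe.ringHom (z + (i : ℤ_[p])) := by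
    rw [map_add, map_natCast, Rat.cast_add, Rat.cast_natCast, ← hz]
    rfl
  have heval : ((⦅x⦆_k : ℚ) : ℚ_[p]) = ((⦅z⦆_k : ℤ_[p]) : ℚ_[p]) := by
    simp only [ascPochhammer_eval_eq_prod, Rat.cast_prod, hfactor]
    exact (map_prod PadicInt.Coe.ringHom _ _).symm
  have h := PadicInt.norm_ascPochhammer_le k z
  rw [PadicInt.norm_def, PadicInt.norm_def, ← heval, PadicInt.coe_natCast] at h
  rw [mem_zero_iff, Rat.cast_div, Rat.cast_natCast, norm_div]
  exact div_le_one_of_le₀ h (norm_nonneg _)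

theorem ascPochhammer_eval_div_factorial_mem_one {i k : ℕ} (hx : x + i ∈ padicIdeal p s)
    (hik : i < k) (hks : k < p ^ s) : ⦅x⦆_k / k ! ∈ padicIdeal p 1 := by
  induction i generalizing x k with
  | zero =>
    obtain ⟨k, rfl⟩ := Nat.exists_eq_succ_of_ne_zero hik.ne'
    rw [Nat.cast_zero, add_zero] at hx
    have hx' : x + 1 ∈ padicIdeal p 0 := add_mem (antitone s.zero_le hx) one_mem
    have hsplit : ⦅x⦆_(k + 1) / (k + 1)! = x / (k + 1 : ℕ) * (⦅x + 1⦆_k / k !) := by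
      rw [ascPochhammer_eval_succ_left, Nat.factorial_succ, Nat.cast_mul, mul_div_mul_comm]
    exact hsplit ▸ mul_right_mem (div_natCast_mem hx hik hks)
      (ascPochhammer_eval_div_factorial_mem hx' k)
  | succ i ih =>
    obtain ⟨k, rfl⟩ := Nat.exists_eq_succ_of_ne_zero (Nat.ne_zero_of_lt hik)
    have hx' : x + 1 + i ∈ padicIdeal p s := by
      convert hx using 1
      push_cast
      ring
    have pascal : ⦅x⦆_(k + 1) / (k + 1)! = ⦅x + 1⦆_(k + 1) / (k + 1)! - ⦅x + 1⦆_k / k ! := by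
      have := k.factorial_ne_zero
      rw [ascPochhammer_eval_succ_left, ascPochhammer_succ_eval, Nat.factorial_succ]
      push_cast
      field_simp
      ring
    exact pascal ▸ sub_mem (ih hx' (by omega) hks) (ih hx' (by omega) (by omega))

theorem prod_one_sub_sub_one_sub_sum_mem {ι : Type*} {S : Finset ι} {ε : ι → ℚ}
    (h : ∀ i ∈ S, ε i ∈ padicIdeal p m) :
    ∏ i ∈ S, (1 - ε i) - (1 - ∑ i ∈ S, ε i) ∈ padicIdeal p (m + m) := by
  induction S using Finset.cons_induction with
  | empty => simp
  | cons i S hi ih =>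
    have hi' := h i (mem_cons_self i S)
    have hS : ∀ j ∈ S, ε j ∈ padicIdeal p m := fun j hj ↦ h j (mem_cons_of_mem hj)
    have hsplit : ∏ j ∈ cons i S hi, (1 - ε j) - (1 - ∑ j ∈ cons i S hi, ε j) =
        (1 - ε i) * (∏ j ∈ S, (1 - ε j) - (1 - ∑ j ∈ S, ε j)) + ε i * ∑ j ∈ S, ε j := by
      rw [prod_cons, sum_cons]
      ring
    rw [hsplit]
    exact add_mem (mul_left_mem (sub_mem one_mem (antitone m.zero_le hi')) (ih hS))
      (SetLike.mul_mem_graded hi' (sum_mem hS))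

theorem prod_one_sub_sub_one_mem {ι : Type*} {S : Finset ι} {ε : ι → ℚ}
    (h : ∀ i ∈ S, ε i ∈ padicIdeal p m) : ∏ i ∈ S, (1 - ε i) - 1 ∈ padicIdeal p m := by
  have := sub_mem (antitone (Nat.le_add_left m m) (prod_one_sub_sub_one_sub_sum_mem h)) (sum_mem h)
  convert this using 1
  ring

theorem inv_sub_one_mem (hm : 1 ≤ m) (hx : x - 1 ∈ padicIdeal p m) : x⁻¹ - 1 ∈ padicIdeal p m := by
  have hx' := antitone hm hx
  have := ne_zero_of_sub_one_mem hx'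
  convert mul_left_mem (inv_mem_of_sub_one_mem hx') (neg_mem hx) using 1
  field_simp
  ring

theorem mul_two_sub_inv_sub_mem {σ τ : ℚ} (hm : 1 ≤ m) (hσ : σ ∈ padicIdeal p m)
    (hτ : τ ∈ padicIdeal p m) (hx : x - (1 - σ) ∈ padicIdeal p (m + m))
    (hy : y - (1 - τ) ∈ padicIdeal p (m + m)) :
    x * (2 - y⁻¹) - (1 - (τ + σ)) ∈ padicIdeal p (m + m) := by
  have hle : m ≤ m + m := Nat.le_add_left m m
  have hx1 : x - 1 ∈ padicIdeal p m := by
    convert sub_mem (antitone hle hx) hσ using 1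
    ring
  have hy1 : y - 1 ∈ padicIdeal p 1 := antitone hm <| by
    convert sub_mem (antitone hle hy) hτ using 1
    ring
  have hy0 := ne_zero_of_sub_one_mem hy1
  have hτ0 := antitone m.zero_le hτ
  have hinv : y⁻¹ - (1 + τ) ∈ padicIdeal p (m + m) := by
    have : y⁻¹ - (1 + τ) = y⁻¹ * (τ * τ - (y - (1 - τ)) * (1 + τ)) := by
      field_simp
      ring
    exact this ▸ mul_left_mem (inv_mem_of_sub_one_mem hy1)
      (sub_mem (SetLike.mul_mem_graded hτ hτ) (mul_right_mem hy (add_mem one_mem hτ0)))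
  have : x * (2 - y⁻¹) - (1 - (τ + σ)) =
      (x - (1 - σ)) * (1 - τ) + σ * τ - x * (y⁻¹ - (1 + τ)) := by ring
  exact this ▸ sub_mem (add_mem (mul_right_mem hx (sub_mem one_mem hτ0))
    (SetLike.mul_mem_graded hσ hτ)) (mul_left_mem (mem_zero_of_sub_one_mem hx1) hinv)

theorem div_sub_natCast_mem {t : ℕ} (hx : x ∈ padicIdeal p s) (hy : y ∈ padicIdeal p s)
    (ht : 0 < t) (hts : t < p ^ s) : x / (y - t) ∈ padicIdeal p 1 := by
  have ht0 : (t : ℚ) ≠ 0 := by exact_mod_cast ht.ne'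
  have hunit : 1 - y / t - 1 ∈ padicIdeal p 1 := by
    simpa using neg_mem (div_natCast_mem hy ht hts)
  have hsplit : x / (y - t) = -(x / t) * (1 - y / t)⁻¹ := by
    rw [one_sub_div ht0, inv_div, ← neg_sub (t : ℚ) y, div_neg, neg_mul, div_mul_div_cancel₀ ht0]
  exact hsplit ▸ mul_right_mem (neg_mem (div_natCast_mem hx ht hts)) (inv_mem_of_sub_one_mem hunit)

theorem sq_mem (hx : x ∈ padicIdeal p 1) : x ^ 2 ∈ padicIdeal p 2 :=
  SetLike.pow_mem_graded 2 hx

theorem sq_div_one_add_natCast_mem {i : ℕ} (hx : x ∈ padicIdeal p s) (hi : i + 1 < p ^ s) :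
    (x / (1 + i)) ^ 2 ∈ padicIdeal p 2 := by
  refine sq_mem ?_
  rw [add_comm]
  exact_mod_cast div_natCast_mem hx i.succ_pos hi

theorem symmPochhammer_one_sub_one_mem {k : ℕ} (hx : x ∈ padicIdeal p s) (hk : k < p ^ s) :
    symmPochhammer 1 x k - 1 ∈ padicIdeal p 2 := by
  rw [symmPochhammer_one_eq_prod]
  exact prod_one_sub_sub_one_mem fun i hi ↦ sq_div_one_add_natCast_mem hx
    (by have := mem_range.mp hi; omega)

theorem symmPochhammer_one_ne_zero {k : ℕ} (hx : x ∈ padicIdeal p s) (hk : k < p ^ s) :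
    symmPochhammer 1 x k ≠ 0 :=
  ne_zero_of_sub_one_mem (antitone one_le_two (symmPochhammer_one_sub_one_mem hx hk))

variable {a : ℚ} {M : ℕ}

theorem sq_div_add_natCast_mem {i : ℕ} (hN : a + M ∈ padicIdeal p s) (hM : M < p ^ s)
    (hi : i < M) : ((a + M) / (a + i)) ^ 2 ∈ padicIdeal p 2 := by
  have : a + i = a + M - (M - i : ℕ) := by
    push_cast [hi.le]
    ring
  exact sq_mem (this ▸ div_sub_natCast_mem hN hN (by omega) (by omega))

theorem ascPochhammer_eval_one_sub_div_factorial_mem {k : ℕ} (hN : a + M ∈ padicIdeal p s)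
    (hM : M < p ^ s) (hk : k < p ^ s) (hMk : p ^ s ≤ M + k) :
    ⦅1 - a⦆_k / k ! ∈ padicIdeal p 1 := by
  refine ascPochhammer_eval_div_factorial_mem_one (i := p ^ s - (M + 1)) ?_ (by omega) hk
  convert sub_mem (prime_pow_mem s) hN using 1
  push_cast [Nat.succ_le_of_lt hM]
  ring

theorem ascPochhammer_eval_succ_div_factorial_mem (ha : a ∈ padicIdeal p 0)
    (hN : a + M ∈ padicIdeal p s) (hchoose : ¬ p ∣ m.choose M) :
    ⦅a⦆_(m + 1) / m ! ∈ padicIdeal p s := by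
  have hMm := le_of_not_dvd_choose hchoose
  obtain ⟨l, rfl⟩ := Nat.exists_eq_add_of_le hMm
  have hfac : ((M + l)! : ℚ) = (M + l).choose M * M ! * l ! := by
    have := Nat.choose_mul_factorial_mul_factorial hMm
    rw [Nat.add_sub_cancel_left] at this
    exact_mod_cast this.symm
  have hsplit : ⦅a⦆_(M + l + 1) / (M + l)! = (a + M) * ((⦅a⦆_M / M !) *
      (⦅a + M + 1⦆_l / l !) * ((M + l).choose M : ℚ)⁻¹) := by
    rw [add_assoc, ascPochhammer_eval_add, ascPochhammer_eval_succ_left, hfac]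
    simp only [div_eq_mul_inv, mul_inv]
    ring
  have hN1 : a + M + 1 ∈ padicIdeal p 0 := add_mem (add_mem ha (natCast_mem M)) one_mem
  exact hsplit ▸ mul_right_mem hN (mul_left_mem (mul_left_mem
    (ascPochhammer_eval_div_factorial_mem ha M) (ascPochhammer_eval_div_factorial_mem hN1 l))
    (inv_natCast_mem hchoose))

theorem vwpCoeff_mem {q t : ℕ × ℕ} (ha : a ∈ padicIdeal p 0) (hN : a + M ∈ padicIdeal p s)
    (hM : 2 * p ^ s ≤ 3 * M + 1) (hm : m < p ^ s) (hchoose : ¬ p ∣ m.choose M)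
    (hq : q.1 + q.2 = m) (ht : t.1 + t.2 = q.1) : vwpCoeff a m q t ∈ padicIdeal p (s + 1) := by
  have hMm := le_of_not_dvd_choose hchoose
  have hMs := hMm.trans_lt hm
  have hnat := natCast_mem (p := p)
  have f₁ := ascPochhammer_eval_div_factorial_mem ha q.1
  have f₂ := ascPochhammer_eval_div_factorial_mem (add_mem (add_mem one_mem ha) (hnat m)) q.1
  have f₃ := ascPochhammer_eval_div_factorial_mem (add_mem (add_mem one_mem ha) (hnat q.1)) q.2
  have f₄ := ascPochhammer_eval_div_factorial_mem (sub_mem one_mem ha) t.1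
  have f₅ := ascPochhammer_eval_div_factorial_mem (sub_mem one_mem ha) t.2
  have hleading : (-1 : ℚ) ^ q.1 * (⦅a⦆_(m + 1) / m !) ∈ padicIdeal p s :=
    mul_left_mem (by exact_mod_cast SetLike.intCast_mem_graded (padicIdeal p) ((-1) ^ q.1))
      (ascPochhammer_eval_succ_div_factorial_mem ha hN hchoose)
  have hsplit : vwpCoeff a m q t = (-1) ^ q.1 * (⦅a⦆_(m + 1) / m !) *
      ((⦅a⦆_q.1 / q.1 !) * (⦅1 + a + m⦆_q.1 / q.1 !) * (⦅1 + a + q.1⦆_q.2 / q.2 !) *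
        ((⦅1 - a⦆_t.1 / t.1 !) * (⦅1 - a⦆_t.2 / t.2 !))) := by
    rw [vwpCoeff]
    ring
  rw [hsplit]
  refine SetLike.mul_mem_graded hleading ?_
  rcases lt_trichotomy q.1 M with h | h | h
  · have hindex : 1 + a + q.1 + (M - (q.1 + 1) : ℕ) = a + M := by
      push_cast [Nat.succ_le_of_lt h]
      ring
    exact mul_right_mem (mul_left_mem (mul_left_mem f₁ f₂) <|
      ascPochhammer_eval_div_factorial_mem_one (hindex ▸ hN) (by omega) (by omega))
      (mul_left_mem f₄ f₅)
  · refine mul_left_mem (mul_left_mem (mul_left_mem f₁ f₂) f₃) ?_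
    -- As `2 * p ^ s ≤ 3 * M + 1`, the larger part of `t.1 + t.2 = M` is at least `p ^ s - M`.
    rcases le_or_gt (p ^ s) (M + t.1) with ht₁ | ht₁
    · exact mul_right_mem
        (ascPochhammer_eval_one_sub_div_factorial_mem hN hMs (by omega) ht₁) f₅
    · exact mul_left_mem f₄
        (ascPochhammer_eval_one_sub_div_factorial_mem hN hMs (by omega) (by omega))
  · exact mul_right_mem (mul_right_mem (mul_right_mem
      (ascPochhammer_eval_div_factorial_mem_one hN h (by omega)) f₂) f₃) (mul_left_mem f₄ f₅)

theorem symmPochhammer_zero_mem (ha : a ∈ padicIdeal p 0) (k : ℕ) :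
    symmPochhammer a 0 k ∈ padicIdeal p 0 := by
  rw [symmPochhammer_zero_right, sq]
  exact mul_left_mem (ascPochhammer_eval_div_factorial_mem ha k)
    (ascPochhammer_eval_div_factorial_mem ha k)

theorem symmPochhammer_zero_sub_mem {j : ℕ} (ha : a ∈ padicIdeal p 0)
    (hne : ∀ i : ℕ, a + i ≠ 0) (hN : a + M ∈ padicIdeal p s) (hM : M < p ^ s) (hj : j < p ^ s) :
    symmPochhammer a 0 j - symmPochhammer a (a + M) j ∈ padicIdeal p 2 := by
  rcases le_or_gt j M with hjM | hjM
  · have hprod : ∏ i ∈ range j, (1 - ((a + M) / (a + i)) ^ 2) - 1 ∈ padicIdeal p 2 :=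
      prod_one_sub_sub_one_mem fun i hi ↦
        sq_div_add_natCast_mem hN hM ((mem_range.mp hi).trans_le hjM)
    rw [symmPochhammer_eq_mul_prod (fun i _ ↦ hne i) (a + M), ← neg_sub, ← mul_sub_one]
    exact neg_mem (mul_left_mem (symmPochhammer_zero_mem ha j) hprod)
  · rw [symmPochhammer_zero_right, symmPochhammer.eq_1 a (a + M), sub_add_cancel_left,
      ascPochhammer_eval_neg_coe_nat_of_lt hjM, mul_zero, zero_div, sub_zero]
    exact sq_mem (ascPochhammer_eval_div_factorial_mem_one hN hjM hj)

theorem symmPochhammer_div_sub_mem {j L : ℕ} (ha : a ∈ padicIdeal p 0)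
    (hne : ∀ i : ℕ, a + i ≠ 0) (hN : a + M ∈ padicIdeal p s) (hM : M < p ^ s) (hj : j < p ^ s)
    (hL : L < p ^ s) :
    symmPochhammer a 0 j / symmPochhammer 1 0 L -
      symmPochhammer a (a + M) j / symmPochhammer 1 (a + M) L ∈ padicIdeal p 2 := by
  have hnum := symmPochhammer_zero_sub_mem ha hne hN hM hj
  have hden := inv_sub_one_mem one_le_two (symmPochhammer_one_sub_one_mem hN hL)
  have hN₀ : symmPochhammer a (a + M) j ∈ padicIdeal p 0 := by
    simpa using sub_mem (symmPochhammer_zero_mem ha j) (antitone (Nat.zero_le 2) hnum)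
  convert sub_mem hnum (mul_left_mem hN₀ hden) using 1
  rw [symmPochhammer_one_zero]
  ring

theorem vwpSum_second_difference_mem (ha : a ∈ padicIdeal p 0) (hne : ∀ z : ℤ, a ≠ z)
    (hN : a + M ∈ padicIdeal p s) (hM : 2 * p ^ s ≤ 3 * M + 1) (hm : m < p ^ s)
    (hchoose : ¬ p ∣ m.choose M) :
    vwpSum a 0 0 m - vwpSum a 0 (a + M) m - vwpSum a (a + M) 0 m + vwpSum a (a + M) (a + M) m ∈
      padicIdeal p (s + 5) := by
  have hMs := (le_of_not_dvd_choose hchoose).trans_lt hm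
  have ha₁ : ∀ k, ⦅1 + a⦆_k ≠ 0 := ascPochhammer_eval_ne_zero_of_forall_ne_intCast
    fun z hz ↦ hne (z - 1) (by push_cast; linarith)
  have hne' (i : ℕ) : a + i ≠ 0 := fun h ↦ hne (-i) (by push_cast; linarith)
  have h₀ : symmPochhammer (1 : ℚ) 0 m ≠ 0 := by simp [symmPochhammer_one_zero]
  have h₁ := symmPochhammer_one_ne_zero hN hm
  rw [vwpSum_eq_sum_vwpCoeff m ha₁ h₀ h₀, vwpSum_eq_sum_vwpCoeff m ha₁ h₀ h₁,
    vwpSum_eq_sum_vwpCoeff m ha₁ h₁ h₀, vwpSum_eq_sum_vwpCoeff m ha₁ h₁ h₁]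
  simp only [← sum_sub_distrib, ← sum_add_distrib]
  refine sum_mem fun q hq ↦ sum_mem fun t ht ↦ ?_
  rw [HasAntidiagonal.mem_antidiagonal] at hq ht
  have hcoeff := vwpCoeff_mem ha hN hM hm hchoose hq ht
  have hv := symmPochhammer_div_sub_mem ha hne' hN hMs (j := t.1) (L := q.1)
    (by omega) (by omega)
  have hu := inv_sub_one_mem one_le_two
    (symmPochhammer_one_sub_one_mem hN (k := t.1) (by omega))
  change _ ∈ padicIdeal p (s + 1 + 2 + 2)
  convert neg_mem (SetLike.mul_mem_graded (SetLike.mul_mem_graded hcoeff hv) hu) using 1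
  rw [symmPochhammer_one_zero t.1]
  ring

theorem ascPochhammer_eval_div_descFactorial_mem {k : ℕ} (hN : a + M ∈ padicIdeal p s)
    (hM : M < p ^ s) (hk : k ≤ M) : ⦅a⦆_k / M.descFactorial k ∈ padicIdeal p 0 := by
  rw [ascPochhammer_eval_eq_prod, Nat.descFactorial_eq_prod_range, Nat.cast_prod,
    ← prod_div_distrib]
  refine prod_induction _ (· ∈ padicIdeal p 0) (fun _ _ ↦ mul_left_mem) one_mem fun i hi ↦ ?_
  have hiM : i < M := (mem_range.mp hi).trans_le hk
  have hfactor : (a + i) / (M - i : ℕ) = (a + M) / (M - i : ℕ) - 1 := by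
    have : ((M - i : ℕ) : ℚ) ≠ 0 := by exact_mod_cast (Nat.sub_pos_of_lt hiM).ne'
    field_simp
    push_cast [hiM.le]
    ring
  rw [hfactor]
  exact sub_mem (antitone zero_le_one (div_natCast_mem hN (by omega) (by omega))) one_mem

theorem whippleTerm_mem {k : ℕ} (ha : a ∈ padicIdeal p 0) (ha2 : ⦅2 * a⦆_k ≠ 0)
    (hN : a + M ∈ padicIdeal p s) (hM : M < p ^ s) (hM' : 2 * p ^ s ≤ 3 * M + 1) (hk : k ≤ M) :
    ⦅2 * a⦆_M / M ! * (⦅a⦆_k ^ 3 * ⦅1 - a⦆_k / (k ! ^ 3 * ⦅2 * a⦆_k)) ∈ padicIdeal p 1 := by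
  have h2ak : 2 * a + k ∈ padicIdeal p 0 :=
    add_mem (mul_left_mem (by exact_mod_cast natCast_mem 2) ha) (natCast_mem k)
  have f₁ := ascPochhammer_eval_div_factorial_mem ha k
  have f₂ := ascPochhammer_eval_div_descFactorial_mem hN hM hk
  have hsplit : ⦅2 * a⦆_M / M ! * (⦅a⦆_k ^ 3 * ⦅1 - a⦆_k / (k ! ^ 3 * ⦅2 * a⦆_k)) =
      ⦅a⦆_k / M.descFactorial k * (⦅a⦆_k / k !) * (⦅a⦆_k / k !) *
        (⦅2 * a + k⦆_(M - k) / (M - k)! * (⦅1 - a⦆_k / k !)) := by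
    rw [← Nat.factorial_mul_descFactorial hk, Nat.cast_mul, ← Nat.add_sub_of_le hk,
      ascPochhammer_eval_add, Nat.add_sub_cancel_left]
    field_simp
  rw [hsplit]
  refine mul_left_mem (mul_left_mem (mul_left_mem f₂ f₁) f₁) ?_
  rcases le_or_gt (p ^ s) (M + k) with hMk | hMk
  · exact mul_left_mem (ascPochhammer_eval_div_factorial_mem h2ak (M - k))
      (ascPochhammer_eval_one_sub_div_factorial_mem hN hM (by omega) hMk)
  · refine mul_right_mem ?_ (ascPochhammer_eval_div_factorial_mem (sub_mem one_mem ha) k)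
    refine ascPochhammer_eval_div_factorial_mem_one (i := 2 * M - p ^ s - k) (s := s) ?_
      (by omega) (by omega)
    convert sub_mem (add_mem hN hN) (prime_pow_mem s) using 1
    push_cast [show p ^ s ≤ 2 * M by omega, show k ≤ 2 * M - p ^ s by omega]
    ring

theorem two_mul_vwpSum_sub_vwpSum_sub_mem (ha : a ∈ padicIdeal p 0) (hne : ∀ z : ℤ, 2 * a ≠ z)
    (hN : a + M ∈ padicIdeal p s) (hM : 2 * p ^ s ≤ 3 * M + 1) (hMs : M < p ^ s) (hMm : M ≤ m) :
    2 * vwpSum a (a + M) 0 m - vwpSum a (a + M) (a + M) m -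
      (a + M) * (⦅2 * a⦆_M / M ! * ∑ k ∈ range (M + 1),
        ⦅a⦆_k ^ 3 * ⦅1 - a⦆_k / (k ! ^ 3 * ⦅2 * a⦆_k) *
          (1 - (∑ i ∈ range k, ((a + M) / (1 + i)) ^ 2 +
            ∑ i ∈ range k, ((a + M) / (a + i)) ^ 2))) ∈ padicIdeal p (s + 5) := by
  have ha₁ : ∀ k, ⦅1 + a⦆_k ≠ 0 := ascPochhammer_eval_ne_zero_of_forall_ne_intCast
    fun z hz ↦ hne (2 * (z - 1)) (by push_cast; linarith)
  have ha₂ := ascPochhammer_eval_ne_zero_of_forall_ne_intCast hne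
  have hai (i : ℕ) : a + i ≠ 0 := fun h ↦ hne (2 * -i) (by push_cast; linarith)
  have h₀ : symmPochhammer (1 : ℚ) 0 M ≠ 0 := by simp [symmPochhammer_one_zero]
  have h₁ := symmPochhammer_one_ne_zero hN hMs
  rw [vwpSum_add_natCast hMm ha₁ ha₂ h₁ h₀, vwpSum_add_natCast hMm ha₁ ha₂ h₁ h₁]
  have hsum : ∑ k ∈ range (M + 1),
      ⦅2 * a⦆_M / M ! * (⦅a⦆_k ^ 3 * ⦅1 - a⦆_k / (k ! ^ 3 * ⦅2 * a⦆_k)) *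
        ((∏ i ∈ range k, (1 - ((a + M) / (a + i)) ^ 2)) *
            (2 - (∏ i ∈ range k, (1 - ((a + M) / (1 + i)) ^ 2))⁻¹) -
          (1 - (∑ i ∈ range k, ((a + M) / (1 + i)) ^ 2 +
            ∑ i ∈ range k, ((a + M) / (a + i)) ^ 2))) ∈ padicIdeal p (1 + (2 + 2)) := by
    refine sum_mem fun k hk ↦ ?_
    have hkM := Nat.lt_succ_iff.mp (mem_range.mp hk)
    have hσ : ∀ i ∈ range k, ((a + M) / (a + i)) ^ 2 ∈ padicIdeal p 2 := fun i hi ↦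
      sq_div_add_natCast_mem hN hMs ((mem_range.mp hi).trans_le hkM)
    have hτ : ∀ i ∈ range k, ((a + M) / (1 + i)) ^ 2 ∈ padicIdeal p 2 := fun i hi ↦
      sq_div_one_add_natCast_mem hN (by have := mem_range.mp hi; omega)
    exact SetLike.mul_mem_graded (whippleTerm_mem ha (ha₂ k) hN hMs hM hkM)
      (mul_two_sub_inv_sub_mem one_le_two (sum_mem hσ) (sum_mem hτ)
        (prod_one_sub_sub_one_sub_sum_mem hσ) (prod_one_sub_sub_one_sub_sum_mem hτ))
  convert SetLike.mul_mem_graded hN hsum using 1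
  simp only [symmPochhammer_one_zero, div_one]
  simp only [symmPochhammer_eq_mul_prod (fun i _ ↦ hai i) (a + M), symmPochhammer_zero_right,
    symmPochhammer_one_eq_prod (a + M), mul_sum, ← sum_sub_distrib]
  exact sum_congr rfl fun k _ ↦ by ring

theorem vwpSum_sub_mem (ha : a ∈ padicIdeal p 0) (hne : ∀ z : ℤ, 2 * a ≠ z)
    (hN : a + M ∈ padicIdeal p s) (hM : 2 * p ^ s ≤ 3 * M + 1) (hm : m < p ^ s)
    (hchoose : ¬ p ∣ m.choose M) :
    vwpSum a 0 0 m - (a + M) * (⦅2 * a⦆_M / M ! * ∑ k ∈ range (M + 1),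
      ⦅a⦆_k ^ 3 * ⦅1 - a⦆_k / (k ! ^ 3 * ⦅2 * a⦆_k) *
        (1 - (∑ i ∈ range k, ((a + M) / (1 + i)) ^ 2 +
          ∑ i ∈ range k, ((a + M) / (a + i)) ^ 2))) ∈ padicIdeal p (s + 5) := by
  have hMm := le_of_not_dvd_choose hchoose
  have second_difference := vwpSum_second_difference_mem ha
    (fun z hz ↦ hne (2 * z) (by push_cast; rw [hz])) hN hM hm hchoose
  convert add_mem second_difference
    (two_mul_vwpSum_sub_vwpSum_sub_mem ha hne hN hM (hMm.trans_lt hm) hMm) using 1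
  rw [vwpSum_comm a 0 (a + M)]
  ring

end padicIdeal

theorem sum_Icc_one_eq_sum_range {M : Type*} [AddCommMonoid M] (f : ℕ → M) (k : ℕ) :
    ∑ j ∈ Icc 1 k, f j = ∑ i ∈ range k, f (i + 1) := by
  rw [range_eq_Ico, sum_Ico_add', zero_add, Ico_add_one_right_eq_Icc]

theorem mul_vwpSum_zero_zero {K : Type*} [Field K] [CharZero K] (c a : K) (m : ℕ) :
    c * vwpSum a 0 0 m =
      ∑ k ∈ range (m + 1), (2 * c * k + c * a) * (⦅a⦆_k ^ 6 / k ! ^ 6) := by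
  rw [vwpSum, mul_sum]
  refine sum_congr rfl fun k _ ↦ ?_
  rw [symmPochhammer_one_zero, symmPochhammer_zero_right]
  ring

theorem mul_one_sub_sum_sq_eq {K : Type*} [Field K] {c : K} (hc : c ≠ 0) (a x : K) (k : ℕ) :
    c * x * (1 - (∑ i ∈ range k, (x / (1 + i)) ^ 2 + ∑ i ∈ range k, (x / (a + i)) ^ 2)) =
      c * x - (c * x) ^ 3 *
        ∑ j ∈ Icc 1 k, (1 / (c * j) ^ 2 + 1 / (c * j - c + c * a) ^ 2) := by
  rw [sum_Icc_one_eq_sum_range, ← sum_add_distrib, mul_sub, mul_one, mul_sum, mul_sum]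
  refine congrArg _ (sum_congr rfl fun i _ ↦ ?_)
  have hshift : c * (i + 1 : ℕ) - c + c * a = c * (a + i) := by
    push_cast
    ring
  rw [hshift, Nat.cast_succ, add_comm (i : K)]
  generalize 1 + (i : K) = y, a + (i : K) = z
  simp only [div_eq_mul_inv, mul_inv, mul_pow]
  field_simp

theorem mul_mul_sum_mul_one_sub_sum_sq {K : Type*} [Field K] {c : K} (hc : c ≠ 0) (a x b : K)
    (w : ℕ → K) (S : Finset ℕ) :
    c * (x * (b * ∑ k ∈ S, w k *
        (1 - (∑ i ∈ range k, (x / (1 + i)) ^ 2 + ∑ i ∈ range k, (x / (a + i)) ^ 2)))) =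
      b * ∑ k ∈ S, w k * (c * x - (c * x) ^ 3 *
        ∑ j ∈ Icc 1 k, (1 / (c * j) ^ 2 + 1 / (c * j - c + c * a) ^ 2)) := by
  rw [← mul_assoc, mul_left_comm, mul_sum]
  simp only [mul_left_comm (c * x), mul_one_sub_sum_sq_eq hc]

theorem int_div_natCast_ne_intCast {d : ℕ} {c : ℤ} (hd : d ≠ 0) (h : ¬ (d : ℤ) ∣ c) (z : ℤ) :
    (c : ℚ) / d ≠ z := fun hz ↦ h ⟨z, by
  rw [div_eq_iff (by exact_mod_cast hd), mul_comm] at hz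
  exact_mod_cast hz⟩

theorem isCoprime_of_prime_pow_modEq_neg {d s p : ℕ} {r : ℤ} (hpd : Nat.gcd p d = 1)
    (hmod : (p : ℤ) ^ s ≡ -r [ZMOD d]) : IsCoprime (d : ℤ) r := by
  obtain ⟨c, hc⟩ := hmod.dvd
  have hpow : IsCoprime (d : ℤ) ((p : ℤ) ^ s) :=
    (Nat.isCoprime_iff_coprime.mpr hpd).symm.pow_right
  have hr : r = -(p : ℤ) ^ s + d * -c := by linear_combination -hc
  exact hr ▸ hpow.neg_right.add_mul_left_right (-c)

theorem two_mul_le_three_mul_truncIndex {d n : ℕ} {r : ℤ} (hd : 0 < d)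
    (hr : 3 * r ≤ (d - 3) * n + d)
    (hspec : (d : ℤ) * truncIndex d n r = d * n - n - r) : 2 * n ≤ 3 * truncIndex d n r + 1 := by
  have h : (d : ℤ) * (2 * n) ≤ d * (3 * truncIndex d n r + 1) := by linarith
  exact_mod_cast le_of_mul_le_mul_left h (by exact_mod_cast hd)

theorem truncIndex_lt {d n : ℕ} {r : ℤ} (hd : 0 < d) (hn : 0 < n) (hr : -n < r) :
    truncIndex d n r < n := by
  rw [truncIndex, Int.toNat_lt' hn]
  exact Int.ediv_lt_of_lt_mul (by exact_mod_cast hd) (by linarith)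

theorem not_dvd_choose_prime_pow_sub_one {p : ℕ} (hp : p.Prime) (s k : ℕ) (hk : k < p ^ s) :
    ¬ p ∣ (p ^ s - 1).choose k := by
  induction k with
  | zero => simpa using hp.one_lt.ne'
  | succ k ih =>
    have pascal := Nat.choose_succ_succ (p ^ s - 1) k
    rw [Nat.succ_eq_add_one, Nat.sub_add_cancel (by omega)] at pascal
    have hdvd : p ∣ (p ^ s).choose (k + 1) := hp.dvd_choose_pow k.succ_ne_zero hk.ne
    exact fun h ↦ ih (by omega) ((Nat.dvd_add_left h).mp (pascal ▸ hdvd))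

theorem lt_and_not_dvd_choose {p s m M : ℕ} (hp : p.Prime) (hM : M < p ^ s)
    (hm : m = M ∨ m = p ^ s - 1) : m < p ^ s ∧ ¬ p ∣ m.choose M := by
  rcases hm with rfl | rfl
  · simpa using ⟨hM, hp.one_lt.ne'⟩
  · exact ⟨Nat.sub_one_lt_of_lt hM, not_dvd_choose_prime_pow_sub_one hp s M hM⟩

theorem corollary5p5_general (d s p : ℕ) (r : ℤ) (hp : p.Prime) (hd : 3 ≤ d)
    (hr : 3 * r ≤ ((d : ℤ) - 3) * (p : ℤ) ^ s + d) (hpd : Nat.gcd p d = 1)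
    (hmod : (p : ℤ) ^ s ≡ -r [ZMOD (d : ℤ)]) (m : ℕ) (hm : m < p ^ s)
    (hchoose : ¬ p ∣ m.choose (truncIndex d (p ^ s) r)) :
    RatCongr p (s + 5)
      (∑ k ∈ range (m + 1),
        (2 * (d : ℚ) * (k : ℚ) + (r : ℚ)) *
          (shiftedFactorial ((r : ℚ) / (d : ℚ)) k ^ 6 / ((k ! : ℕ) : ℚ) ^ 6))
      (shiftedFactorial (2 * (r : ℚ) / (d : ℚ)) (truncIndex d (p ^ s) r) /
          shiftedFactorial 1 (truncIndex d (p ^ s) r) *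
        ∑ k ∈ range (truncIndex d (p ^ s) r + 1),
          (shiftedFactorial ((r : ℚ) / (d : ℚ)) k ^ 3 *
              shiftedFactorial (1 - (r : ℚ) / (d : ℚ)) k /
            (((k ! : ℕ) : ℚ) ^ 3 * shiftedFactorial (2 * (r : ℚ) / (d : ℚ)) k)) *
          (((d : ℚ) - 1) * (p : ℚ) ^ s -
            ((d : ℚ) - 1) ^ 3 * (p : ℚ) ^ (3 * s) *
              ∑ j ∈ Icc 1 k,
                (1 / ((d : ℚ) * (j : ℚ)) ^ 2 +
                  1 / ((d : ℚ) * (j : ℚ) - (d : ℚ) + (r : ℚ)) ^ 2))) := by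
  have : Fact p.Prime := ⟨hp⟩
  have hd0 : (d : ℚ) ≠ 0 := by positivity
  have hspec := truncIndex_spec d (p ^ s) r (by omega) (by
    have : (d : ℤ) * 1 ≤ d * (p ^ s : ℕ) := by gcongr; exact_mod_cast Nat.one_le_pow s p hp.pos
    push_cast at this ⊢
    linarith) (by exact_mod_cast hmod)
  have hM := two_mul_le_three_mul_truncIndex (by omega) (by exact_mod_cast hr) hspec
  have hcoprime := isCoprime_of_prime_pow_modEq_neg hpd hmod
  have hndvd : ¬ (d : ℤ) ∣ 2 * r := fun h ↦ by
    have := Int.le_of_dvd two_pos (hcoprime.dvd_of_dvd_mul_right h)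
    omega
  have hpd' := hp.coprime_iff_not_dvd.mp hpd
  set M := truncIndex d (p ^ s) r
  have h2a : 2 * (r : ℚ) / d = 2 * (r / d) := mul_div_assoc 2 (r : ℚ) (d : ℚ)
  set a : ℚ := r / d
  have hda : d * a = r := mul_div_cancel₀ _ hd0
  have hdN : d * (a + M) = (d - 1) * p ^ s := by
    have : (d : ℚ) * M = d * p ^ s - p ^ s - r := by exact_mod_cast hspec
    linear_combination hda + this
  have hne (z : ℤ) : 2 * a ≠ z := by
    rw [← h2a]
    exact_mod_cast int_div_natCast_ne_intCast (by omega) hndvd z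
  have ha : a ∈ padicIdeal p 0 := padicIdeal.mem_of_natCast_mul_mem hpd'
    (hda ▸ SetLike.intCast_mem_graded (padicIdeal p) r)
  have hN : a + M ∈ padicIdeal p s := padicIdeal.mem_of_natCast_mul_mem hpd' <| hdN ▸
    padicIdeal.mul_left_mem (sub_mem (padicIdeal.natCast_mem d) padicIdeal.one_mem)
      (padicIdeal.prime_pow_mem s)
  refine padicIdeal.ratCongr_of_sub_mem ?_
  convert padicIdeal.mul_left_mem (padicIdeal.natCast_mem d)
    (padicIdeal.vwpSum_sub_mem ha hne hN hM hm hchoose) using 1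
  simp only [shiftedFactorial]
  rw [mul_sub, mul_vwpSum_zero_zero, mul_mul_sum_mul_one_sub_sum_sq hd0, hda, hdN, h2a,
    ascPochhammer_eval_one, mul_pow, ← pow_mul, mul_comm s]

theorem corollary5p5 (d s p : ℕ) (r : ℤ) (hp : p.Prime) (hp_odd : Odd p) (hs : 0 < s)
    (hr : r = 1 ∨ r = -1) (hd : 3 ≤ d) (hdn : (d : ℤ) ≤ (p : ℤ) ^ s + r)
    (hpd : Nat.gcd p d = 1) (hmod : (p : ℤ) ^ s ≡ -r [ZMOD (d : ℤ)])
    (m : ℕ) (hm : m = truncIndex d (p ^ s) r ∨ m = p ^ s - 1) :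
    RatCongr p (s + 5)
      (∑ k ∈ range (m + 1),
        (2 * (d : ℚ) * (k : ℚ) + (r : ℚ)) *
          (shiftedFactorial ((r : ℚ) / (d : ℚ)) k ^ 6 / ((k ! : ℕ) : ℚ) ^ 6))
      (shiftedFactorial (2 * (r : ℚ) / (d : ℚ)) (truncIndex d (p ^ s) r) /
          shiftedFactorial 1 (truncIndex d (p ^ s) r) *
        ∑ k ∈ range (truncIndex d (p ^ s) r + 1),
          (shiftedFactorial ((r : ℚ) / (d : ℚ)) k ^ 3 *
              shiftedFactorial (1 - (r : ℚ) / (d : ℚ)) k /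
            (((k ! : ℕ) : ℚ) ^ 3 * shiftedFactorial (2 * (r : ℚ) / (d : ℚ)) k)) *
          (((d : ℚ) - 1) * (p : ℚ) ^ s -
            ((d : ℚ) - 1) ^ 3 * (p : ℚ) ^ (3 * s) *
              ∑ j ∈ Icc 1 k,
                (1 / ((d : ℚ) * (j : ℚ)) ^ 2 +
                  1 / ((d : ℚ) * (j : ℚ) - (d : ℚ) + (r : ℚ)) ^ 2))) := by
  obtain ⟨hms, hchoose⟩ := lt_and_not_dvd_choose hp
    (truncIndex_lt (by omega) (pow_pos hp.pos s) (by push_cast; omega)) hm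
  exact corollary5p5_general d s p r hp hd
    (le_add_of_nonneg_of_le (mul_nonneg (by omega) (by positivity)) (by omega))
    hpd hmod m hms hchoose
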